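/- For an integer $n \ge 10$ let $H_n = P_{2,2;\,n-4}^{2,\,n-7}$ be the graph on $n$ vertices obtained from the path with vertices $0,1,\dots,n-5$ (consecutive integers being adjacent) by attaching a pendant path with two edges at the vertex $2$ and another pendant path with two edges at the vertex $n-7$. Let $\rho(H_n)$ denote the index of $H_n$, i.e. the largest eigenvalue of its adjacency matrix (equivalently, its spectral radius). Then, for every integer $n \ge 10$, $$\sqrt{2+\sqrt5} \;<\; \rho(H_n) \;<\; \frac{3\sqrt2}{2} \quad\text{if and only if}\quad n \ge 12.$$ -/

import Mathlib

/-- One orientation of the edges of an open quipu. The vertices are those of the path `P_r`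
(`Sum.inl 0, …, Sum.inl (r - 1)`) and, for each `i`, the `k i` new vertices
`Sum.inr ⟨i, 0⟩, …, Sum.inr ⟨i, k i - 1⟩` of the pendant path (of `k i` edges) that is
attached at the vertex `m i` of `P_r`. -/
def quipuRel {t : ℕ} (r : ℕ) (m k : Fin t → ℕ) :
    (Fin r ⊕ (Σ i : Fin t, Fin (k i))) → (Fin r ⊕ (Σ i : Fin t, Fin (k i))) → Prop
  | Sum.inl a, Sum.inl b => (a : ℕ) + 1 = (b : ℕ)
  | Sum.inl a, Sum.inr x => (a : ℕ) = m x.1 ∧ (x.2 : ℕ) = 0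
  | Sum.inr _, Sum.inl _ => False
  | Sum.inr x, Sum.inr y => x.1 = y.1 ∧ (x.2 : ℕ) + 1 = (y.2 : ℕ)

instance quipuRelDecidable {t : ℕ} (r : ℕ) (m k : Fin t → ℕ) :
    DecidableRel (quipuRel r m k) := fun x y =>
  match x, y with
  | Sum.inl a, Sum.inl b => inferInstanceAs (Decidable ((a : ℕ) + 1 = (b : ℕ)))
  | Sum.inl a, Sum.inr x => inferInstanceAs (Decidable ((a : ℕ) = m x.1 ∧ (x.2 : ℕ) = 0))
  | Sum.inr _, Sum.inl _ => inferInstanceAs (Decidable False)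
  | Sum.inr x, Sum.inr y => inferInstanceAs (Decidable (x.1 = y.1 ∧ (x.2 : ℕ) + 1 = (y.2 : ℕ)))

/-- The open quipu `P_{k₁,…,k_t; r}^{m₁,…,m_t}` (meant for `0 < m₁ < ⋯ < m_t < r - 1`): the
graph obtained from the path `P_r` by attaching at its vertex `m i` a pendant path of `k i`
edges, for each `i`. -/
def openQuipu {t : ℕ} (r : ℕ) (m k : Fin t → ℕ) :
    SimpleGraph (Fin r ⊕ (Σ i : Fin t, Fin (k i))) :=
  SimpleGraph.fromRel (quipuRel r m k)

instance openQuipuDecidable {t : ℕ} (r : ℕ) (m k : Fin t → ℕ) :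
    DecidableRel (openQuipu r m k).Adj := fun x y =>
  inferInstanceAs (Decidable (x ≠ y ∧ (quipuRel r m k x y ∨ quipuRel r m k y x)))

/-- The H-shape graph `H_n = P_{2,2; n-4}^{2, n-7}` (meant for `n ≥ 10`). -/
abbrev hGraph (n : ℕ) :
    SimpleGraph (Fin (n - 4) ⊕ (Σ i : Fin 2, Fin ((![2, 2] : Fin 2 → ℕ) i))) :=
  openQuipu (n - 4) ![2, n - 7] ![2, 2]

/-- The index `ρ(G)` of a finite graph: the largest eigenvalue of its adjacency matrix. -/
noncomputable def graphIndex {V : Type*} [Fintype V] [DecidableEq V]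
    (G : SimpleGraph V) [DecidableRel G.Adj] : ℝ :=
  sSup (spectrum ℝ (G.adjMatrix ℝ))

/-- The supremum in the definition of the index is a maximum. -/
theorem graphIndex_isGreatest {V : Type*} [Fintype V] [DecidableEq V] [Nonempty V]
    (G : SimpleGraph V) [DecidableRel G.Adj] :
    IsGreatest (spectrum ℝ (G.adjMatrix ℝ)) (graphIndex G) := by
  have hA : (G.adjMatrix ℝ).IsHermitian := by
    rw [Matrix.IsHermitian, Matrix.conjTranspose_eq_transpose_of_trivial]
    exact G.transpose_adjMatrix
  have h := hA.spectrum_real_eq_range_eigenvalues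
  have hne : (spectrum ℝ (G.adjMatrix ℝ)).Nonempty := by
    rw [h]; exact Set.range_nonempty _
  have hfin : (spectrum ℝ (G.adjMatrix ℝ)).Finite := by
    rw [h]; exact Set.finite_range _
  exact ⟨hne.csSup_mem hfin, fun x hx => le_csSup hfin.bddAbove hx⟩

/-! Put `n = d + 9`, with `d` the distance between the two centres. For `t > 0` and `λ = t + t⁻¹`,
the inner path carries multiples of `t ^ i + t ^ (d - i)`, which solve the eigenvalue recurrence,
and the arms carry `1`, `λ`, `λ² - 1` times `1 + t ^ d`, counted from their tips. This positive
vector satisfies `A x = λ x` except at the two centres, where the same defect is left over. A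
nonpositive defect gives `ρ ≤ λ` (Collatz–Wielandt), a positive one `ρ > λ` (Rayleigh). The two
bounds of the theorem are `λ` at `t² = φ` and at `t² = 2`, so it remains to find signs of the
defect. -/

/-! ### Spectral bounds from trial vectors -/

open Matrix in
/-- Collatz–Wielandt upper bound: a positive vector `x` with `A x ≤ c x` bounds the real
eigenvalues of a nonnegative matrix by `c`. -/
theorem spectrum_le_of_mulVec_le {V : Type*} [Fintype V] [DecidableEq V]
    {A : Matrix V V ℝ} (hA : ∀ i j, 0 ≤ A i j) {x : V → ℝ} (hx : ∀ i, 0 < x i) {c : ℝ}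
    (h : ∀ i, (A *ᵥ x) i ≤ c * x i) {μ : ℝ} (hμ : μ ∈ spectrum ℝ A) : μ ≤ c := by
  rw [← Matrix.spectrum_toLin', ← Module.End.hasEigenvalue_iff_mem_spectrum] at hμ
  obtain ⟨v, hv⟩ := hμ.exists_hasEigenvector
  have hAv : A *ᵥ v = μ • v := by simpa using hv.apply_eq_smul
  obtain ⟨k, hk⟩ : ∃ k, v k ≠ 0 := Function.ne_iff.mp hv.2
  -- At the coordinate maximising `|v j| / x j`, every `|v j|` is at most this ratio times `x j`.
  obtain ⟨i, -, hi⟩ := Finset.exists_max_image Finset.univ (fun j => |v j| / x j) ⟨k, by simp⟩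
  have hi0 : 0 < |v i| / x i :=
    (div_pos (abs_pos.mpr hk) (hx k)).trans_le (hi k (Finset.mem_univ _))
  have hvi : 0 < |v i| := (div_pos_iff_of_pos_right (hx i)).mp hi0
  have hle : μ * |v i| ≤ c * |v i| := by
    calc μ * |v i| ≤ |μ * v i| := by
          rw [abs_mul]; exact mul_le_mul_of_nonneg_right (le_abs_self μ) (abs_nonneg _)
      _ = |∑ j, A i j * v j| := by
          rw [show μ * v i = (A *ᵥ v) i by rw [hAv]; rfl]; rfl
      _ ≤ ∑ j, |A i j * v j| := Finset.abs_sum_le_sum_abs _ _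
      _ ≤ ∑ j, |v i| / x i * (A i j * x j) := by
          refine Finset.sum_le_sum fun j hj => ?_
          rw [abs_mul, abs_of_nonneg (hA i j), mul_left_comm]
          exact mul_le_mul_of_nonneg_left ((div_le_iff₀ (hx j)).mp (hi j hj)) (hA i j)
      _ = |v i| / x i * (A *ᵥ x) i := (Finset.mul_sum _ _ _).symm
      _ ≤ |v i| / x i * (c * x i) := mul_le_mul_of_nonneg_left (h i) hi0.le
      _ = c * |v i| := by field_simp [(hx i).ne']
  exact le_of_mul_le_mul_right hle hvi

open Matrix in
/-- The Rayleigh quotient of any vector is at most the index. -/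
theorem dotProduct_adjMatrix_mulVec_le {V : Type*} [Fintype V] [DecidableEq V] [Nonempty V]
    (G : SimpleGraph V) [DecidableRel G.Adj] (x : V → ℝ) :
    x ⬝ᵥ (G.adjMatrix ℝ *ᵥ x) ≤ graphIndex G * (x ⬝ᵥ x) := by
  set A := G.adjMatrix ℝ
  set ρ := graphIndex G
  have hH : (algebraMap ℝ (Matrix V V ℝ) ρ - A).IsHermitian := by
    rw [Matrix.IsHermitian, Matrix.conjTranspose_eq_transpose_of_trivial, Matrix.transpose_sub,
      G.transpose_adjMatrix, Matrix.algebraMap_eq_diagonal, Matrix.diagonal_transpose]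
  have hP : (algebraMap ℝ (Matrix V V ℝ) ρ - A).PosSemidef := by
    rw [hH.posSemidef_iff_eigenvalues_nonneg]
    intro i
    have hi : hH.eigenvalues i ∈ spectrum ℝ (algebraMap ℝ (Matrix V V ℝ) ρ - A) := by
      rw [hH.spectrum_real_eq_range_eigenvalues]; exact Set.mem_range_self i
    rw [← spectrum.singleton_sub_eq] at hi
    obtain ⟨_, rfl, b, hb, hbi⟩ := hi
    have := (graphIndex_isGreatest G).2 hb
    simp only at hbi
    rw [← hbi]
    exact sub_nonneg.mpr this
  have := hP.dotProduct_mulVec_nonneg x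
  rw [star_trivial, Matrix.sub_mulVec, dotProduct_sub, Algebra.algebraMap_eq_smul_one,
    Matrix.smul_mulVec, Matrix.one_mulVec, dotProduct_smul, smul_eq_mul] at this
  linarith

/-! ### The adjacency operator on symmetric vectors -/

/-- The sum of a function over the neighbours of a vertex of a path. -/
theorem sum_path_neighbours (r a : ℕ) (ha : a < r) (p : ℕ → ℝ) :
    ∑ b : Fin r, (if a + 1 = (b : ℕ) ∨ (b : ℕ) + 1 = a then p b else 0) =
      (if a + 1 < r then p (a + 1) else 0) + (if 1 ≤ a then p (a - 1) else 0) := by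
  rw [Fin.sum_univ_eq_sum_range (fun b => if a + 1 = b ∨ b + 1 = a then p b else 0) r]
  -- The guard `1 ≤ a` matters: by truncated subtraction, `a = 0` would otherwise count as its own
  -- neighbour.
  have : ∀ b, (if a + 1 = b ∨ b + 1 = a then p b else 0) =
      (if a + 1 = b then p b else 0) + (if 1 ≤ a then (if a - 1 = b then p b else 0) else 0) := by
    intro b
    split_ifs <;> first | omega | simp
  simp_rw [this, Finset.sum_add_distrib]
  congr 1
  · simp
  · split_ifs
    · rw [Finset.sum_ite_eq, if_pos (Finset.mem_range.mpr (by omega))]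
    · simp

/-- The H-shape graph with two centres at distance `d`, all four arms having two edges. -/
abbrev hShape (d : ℕ) :
    SimpleGraph (Fin (d + 5) ⊕ (Σ i : Fin 2, Fin ((![2, 2] : Fin 2 → ℕ) i))) :=
  openQuipu (d + 5) ![2, d + 2] ![2, 2]

/-- A vector given by `p` on the long path and by `q` on both pendant paths. -/
def symmVec (d : ℕ) (p q : ℕ → ℝ) :
    (Fin (d + 5) ⊕ (Σ i : Fin 2, Fin ((![2, 2] : Fin 2 → ℕ) i))) → ℝ
  | Sum.inl a => p a
  | Sum.inr y => q y.2

open Matrix in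
theorem hShape_mulVec_inl (d : ℕ) (p q : ℕ → ℝ) (a : Fin (d + 5)) :
    ((hShape d).adjMatrix ℝ *ᵥ symmVec d p q) (Sum.inl a) =
      ((if (a : ℕ) + 1 < d + 5 then p (a + 1) else 0) + (if 1 ≤ (a : ℕ) then p (a - 1) else 0)) +
        ((if (a : ℕ) = 2 then q 0 else 0) + (if (a : ℕ) = d + 2 then q 0 else 0)) := by
  rw [← sum_path_neighbours (d + 5) a a.2 p]
  simp only [mulVec, dotProduct, Fintype.sum_sum_type, SimpleGraph.adjMatrix_apply]
  congr 1
  · refine Finset.sum_congr rfl fun b _ => ?_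
    have : (hShape d).Adj (Sum.inl a) (Sum.inl b) ↔
        ((a : ℕ) + 1 = (b : ℕ) ∨ (b : ℕ) + 1 = a) := by
      simp only [hShape, openQuipu, SimpleGraph.fromRel_adj, quipuRel, ne_eq, Sum.inl.injEq,
        Fin.ext_iff]
      omega
    simp [this, symmVec]
  · rw [Fintype.sum_sigma, Fin.sum_univ_two]
    have : ∀ y, (hShape d).Adj (Sum.inl a) (Sum.inr y) ↔
        ((a : ℕ) = (![2, d + 2] : Fin 2 → ℕ) y.1 ∧ (y.2 : ℕ) = 0) := by
      intro y
      simp [hShape, openQuipu, SimpleGraph.fromRel_adj, quipuRel]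
    simp only [this, symmVec]
    congr 1
    · exact (Fin.sum_univ_two (M := ℝ) _).trans (by simp)
    · exact (Fin.sum_univ_two (M := ℝ) _).trans (by simp)

open Matrix in
theorem hShape_mulVec_inr (d : ℕ) (p q : ℕ → ℝ)
    (y : Σ i : Fin 2, Fin ((![2, 2] : Fin 2 → ℕ) i)) :
    ((hShape d).adjMatrix ℝ *ᵥ symmVec d p q) (Sum.inr y) =
      if (y.2 : ℕ) = 0 then p ((![2, d + 2] : Fin 2 → ℕ) y.1) + q 1 else q 0 := by
  simp only [mulVec, dotProduct, Fintype.sum_sum_type, SimpleGraph.adjMatrix_apply]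
  have h1 : ∀ b : Fin (d + 5), (hShape d).Adj (Sum.inr y) (Sum.inl b) ↔
      ((![2, d + 2] : Fin 2 → ℕ) y.1 = b ∧ (y.2 : ℕ) = 0) := by
    intro b
    simp [hShape, openQuipu, SimpleGraph.fromRel_adj, quipuRel, eq_comm]
  have h2 : ∀ w, (hShape d).Adj (Sum.inr y) (Sum.inr w) ↔
      (y.1 = w.1 ∧ ((y.2 : ℕ) + 1 = w.2 ∨ (w.2 : ℕ) + 1 = y.2)) := by
    intro w
    simp only [hShape, openQuipu, SimpleGraph.fromRel_adj, quipuRel, ne_eq, Sum.inr.injEq]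
    constructor
    · rintro ⟨-, h | h⟩
      · exact ⟨h.1, Or.inl h.2⟩
      · exact ⟨h.1.symm, Or.inr h.2⟩
    · rintro ⟨h, h'⟩
      refine ⟨?_, h'.imp (fun k => ⟨h, k⟩) (fun k => ⟨h.symm, k⟩)⟩
      rintro rfl
      omega
  simp only [h1, h2, symmVec]
  have e1 : ∑ b : Fin (d + 5),
      (if (![2, d + 2] : Fin 2 → ℕ) y.1 = b ∧ (y.2 : ℕ) = 0 then (1 : ℝ) else 0) * p b =
        if (y.2 : ℕ) = 0 then p ((![2, d + 2] : Fin 2 → ℕ) y.1) else 0 := by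
    rw [Fin.sum_univ_eq_sum_range (fun b =>
      (if (![2, d + 2] : Fin 2 → ℕ) y.1 = b ∧ (y.2 : ℕ) = 0 then (1 : ℝ) else 0) * p b) (d + 5)]
    have hlt : (![2, d + 2] : Fin 2 → ℕ) y.1 < d + 5 := by
      obtain ⟨i, j⟩ := y
      fin_cases i <;> simp
    split_ifs with h0
    · simp only [h0, and_true, ite_mul, one_mul, zero_mul]
      rw [Finset.sum_ite_eq, if_pos (Finset.mem_range.mpr hlt)]
    · simp [h0]
  rw [e1, Fintype.sum_sigma, Fin.sum_univ_two]
  obtain ⟨i, j⟩ := y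
  fin_cases i
  all_goals
    change Fin 2 at j
    refine (congrArg₂ (fun s t : ℝ => _ + (s + t)) (Fin.sum_univ_two (M := ℝ) _)
      (Fin.sum_univ_two (M := ℝ) _)).trans ?_
    fin_cases j <;> simp

/-! ### The trial vector and its defect -/

/-- The values, along the long path of `hShape d`, of an eigenvector up to a defect at the two
centres, for the number `t + t⁻¹`. -/
noncomputable def pathValue (t : ℝ) (d a : ℕ) : ℝ :=
  if a = 0 ∨ a = d + 4 then 1 + t ^ d
  else if a = 1 ∨ a = d + 3 then (t + t⁻¹) * (1 + t ^ d)
  else ((t + t⁻¹) ^ 2 - 1) * (t ^ (a - 2) + t ^ (d + 2 - a))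

theorem pathValue_inner (t : ℝ) {d a i j : ℕ} (ha : a = i + 2) (hd : d = i + j) :
    pathValue t d a = ((t + t⁻¹) ^ 2 - 1) * (t ^ i + t ^ j) := by
  subst ha hd
  rw [pathValue, if_neg (by omega), if_neg (by omega), show i + 2 - 2 = i by omega,
    show i + j + 2 - (i + 2) = j by omega]

/-- The values along the pendant paths that go with `pathValue`. -/
noncomputable def armValue (t : ℝ) (d j : ℕ) : ℝ :=
  if j = 0 then (t + t⁻¹) * (1 + t ^ d) else 1 + t ^ d

/-- The trial vector made of `pathValue` and `armValue`. -/
noncomputable def trialVec (t : ℝ) (d : ℕ) :=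
  symmVec d (pathValue t d) (armValue t d)

/-- The defect of `trialVec` at the two centres. -/
noncomputable def centreDefect (t : ℝ) (d : ℕ) : ℝ :=
  (t ^ 4 + t ^ 2 - 1 - t ^ d * (t ^ 2 * (t ^ 4 - t ^ 2 - 1))) / t ^ 3

theorem trialVec_pos {t : ℝ} (ht : 0 < t) (d : ℕ) (v) : 0 < trialVec t d v := by
  have h1 : 0 < (t + t⁻¹) ^ 2 - 1 := by
    have : (t + t⁻¹) ^ 2 - 1 = t ^ 2 + 1 + (t⁻¹) ^ 2 := by field_simp; ring
    rw [this]; positivity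
  rcases v with a | y
  · simp only [trialVec, symmVec, pathValue]
    split_ifs <;> positivity
  · simp only [trialVec, symmVec, armValue]
    split_ifs <;> positivity

open Matrix in
theorem hShape_mulVec_trialVec {t : ℝ} (ht : 0 < t) {d : ℕ} (hd : 1 ≤ d) (v) :
    ((hShape d).adjMatrix ℝ *ᵥ trialVec t d) v = (t + t⁻¹) * trialVec t d v +
      Sum.elim (fun a : Fin (d + 5) => if (a : ℕ) = 2 ∨ (a : ℕ) = d + 2 then centreDefect t d else 0)
        (fun _ => 0) v := by
  have ht' := ht.ne'
  rcases v with ⟨a, ha⟩ | ⟨i, j⟩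
  · rw [trialVec, hShape_mulVec_inl]
    simp only [symmVec, Sum.elim_inl]
    obtain ⟨e, rfl⟩ : ∃ e, d = e + 1 := ⟨d - 1, by omega⟩
    have hc : a = 0 ∨ a = 1 ∨ a = 2 ∨ a = e + 3 ∨ a = e + 4 ∨ a = e + 5 ∨
        (3 ≤ a ∧ a ≤ e + 2) := by omega
    rcases hc with rfl | rfl | rfl | rfl | rfl | rfl | ⟨h3, h4⟩
    · simp [pathValue]
    · simp [pathValue]
      field_simp
      ring
    -- For `e = 0` the next inner vertex is already the other centre.
    · rcases e with _ | e
      · simp [pathValue, armValue, centreDefect]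
        field_simp
        ring
      · simp [pathValue, armValue, centreDefect]
        field_simp
        ring
    · rcases e with _ | e
      · simp [pathValue, armValue, centreDefect]
        field_simp
        ring
      · simp [pathValue, armValue, centreDefect]
        field_simp
        ring
    · simp [pathValue]
      field_simp
      ring
    · simp [pathValue]
    · obtain ⟨b, rfl⟩ : ∃ b, a = b + 3 := ⟨a - 3, by omega⟩
      obtain ⟨f, rfl⟩ : ∃ f, e = b + f + 1 := ⟨e - b - 1, by omega⟩
      rw [if_pos (by omega), if_pos (by omega), if_neg (by omega), if_neg (by omega),
        if_neg (by omega), show b + 3 - 1 = b + 2 by omega,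
        pathValue_inner t (show b + 2 = b + 2 by omega)
          (show b + f + 1 + 1 = b + (f + 2) by omega),
        pathValue_inner t (show b + 3 = b + 1 + 2 by omega)
          (show b + f + 1 + 1 = b + 1 + (f + 1) by omega),
        pathValue_inner t (show b + 3 + 1 = b + 2 + 2 by omega)
          (show b + f + 1 + 1 = b + 2 + f by omega)]
      field_simp
      ring
  · rw [trialVec, hShape_mulVec_inr]
    fin_cases i
    all_goals
      change Fin 2 at j
      fin_cases j <;> simp [symmVec, pathValue, armValue]
      try (field_simp; ring)

/-! ### Comparing the index with `t + t⁻¹` -/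

open Matrix in
theorem graphIndex_hShape_le {t : ℝ} (ht : 0 < t) {d : ℕ} (hd : 1 ≤ d)
    (h : centreDefect t d ≤ 0) : graphIndex (hShape d) ≤ t + t⁻¹ := by
  refine spectrum_le_of_mulVec_le (A := (hShape d).adjMatrix ℝ) (fun i j => ?_)
    (trialVec_pos ht d) (fun v => ?_) (graphIndex_isGreatest (hShape d)).1
  · rw [SimpleGraph.adjMatrix_apply]; split_ifs <;> simp
  · rw [hShape_mulVec_trialVec ht hd]
    rcases v with a | y
    · simp only [Sum.elim_inl]
      split_ifs <;> linarith
    · simp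

-- All entries of the trial vector are positive, so a positive defect pushes its Rayleigh quotient
-- strictly above `t + t⁻¹`.
open Matrix in
theorem lt_graphIndex_hShape {t : ℝ} (ht : 0 < t) {d : ℕ} (hd : 1 ≤ d)
    (h : 0 < centreDefect t d) : t + t⁻¹ < graphIndex (hShape d) := by
  have hR := dotProduct_adjMatrix_mulVec_le (hShape d) (trialVec t d)
  have hpos : 0 < trialVec t d ⬝ᵥ trialVec t d :=
    Finset.sum_pos (fun v _ => mul_pos (trialVec_pos ht d v) (trialVec_pos ht d v))
      Finset.univ_nonempty
  have hlt : (t + t⁻¹) * (trialVec t d ⬝ᵥ trialVec t d) <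
      trialVec t d ⬝ᵥ ((hShape d).adjMatrix ℝ *ᵥ trialVec t d) := by
    rw [dotProduct, dotProduct, Finset.mul_sum]
    refine Finset.sum_lt_sum (fun v _ => ?_) ⟨Sum.inl ⟨2, by omega⟩, Finset.mem_univ _, ?_⟩
    · rw [hShape_mulVec_trialVec ht hd, mul_left_comm]
      refine mul_le_mul_of_nonneg_left (le_add_of_nonneg_right ?_) (trialVec_pos ht d v).le
      rcases v with a | y
      · simp only [Sum.elim_inl]
        split_ifs
        exacts [h.le, le_rfl]
      · simp
    · rw [hShape_mulVec_trialVec ht hd, mul_left_comm]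
      refine mul_lt_mul_of_pos_left (lt_add_of_pos_right _ ?_) (trialVec_pos ht d _)
      simpa using h
  exact lt_of_mul_lt_mul_right (hlt.trans_le hR) hpos.le

/-- At `t² = φ` the factor `t⁴ - t² - 1` vanishes, so the defect is `2φ / t³ > 0` whatever `d` is.
-/
theorem sqrt_two_add_sqrt_five_lt {d : ℕ} (hd : 1 ≤ d) :
    √(2 + √5) < graphIndex (hShape d) := by
  have hφ := Real.goldenRatio_pos
  have h2 : √Real.goldenRatio ^ 2 = Real.goldenRatio := Real.sq_sqrt hφ.le
  have ht : 0 < √Real.goldenRatio := Real.sqrt_pos.mpr hφ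
  have hg := Real.goldenRatio_sq
  have h4 : √Real.goldenRatio ^ 4 = Real.goldenRatio + 1 := by
    rw [← hg, show √Real.goldenRatio ^ 4 = (√Real.goldenRatio ^ 2) ^ 2 by rw [← pow_mul], h2]
  have key : √(2 + √5) = √Real.goldenRatio + (√Real.goldenRatio)⁻¹ := by
    rw [Real.sqrt_eq_iff_mul_self_eq_of_pos (by positivity)]
    have h5 : √5 = 2 * Real.goldenRatio - 1 := by rw [Real.goldenRatio]; ring
    have : (√Real.goldenRatio + (√Real.goldenRatio)⁻¹) * (√Real.goldenRatio + (√Real.goldenRatio)⁻¹)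
        = √Real.goldenRatio ^ 2 + 2 + (√Real.goldenRatio ^ 2)⁻¹ := by
      field_simp; ring
    rw [this, h2, h5]
    generalize Real.goldenRatio = g at hφ hg
    field_simp
    linear_combination -hg
  rw [key]
  refine lt_graphIndex_hShape ht hd (div_pos ?_ (by positivity))
  rw [h4, h2]
  linarith

theorem three_mul_sqrt_two_div_two : √2 + (√2)⁻¹ = 3 * √2 / 2 := by
  have := Real.mul_self_sqrt (show (0 : ℝ) ≤ 2 by norm_num)
  have h : (0 : ℝ) < √2 := by positivity
  field_simp
  linarith

/-- At `t = √2` the numerator of the defect is `5 - 2 t ^ d`, positive since `t ^ d ≤ 2`. -/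
theorem lt_graphIndex_hShape_of_le_two {d : ℕ} (hd : 1 ≤ d) (hd2 : d ≤ 2) :
    3 * √2 / 2 < graphIndex (hShape d) := by
  have h2 : √2 ^ 2 = 2 := Real.sq_sqrt (by norm_num)
  have h4 : √2 ^ 4 = 4 := by rw [show √2 ^ 4 = (√2 ^ 2) ^ 2 by ring, h2]; norm_num
  have h1 : 1 ≤ √2 := Real.one_le_sqrt.mpr (by norm_num)
  rw [← three_mul_sqrt_two_div_two]
  refine lt_graphIndex_hShape (by positivity) hd (div_pos ?_ (by positivity))
  have := pow_le_pow_right₀ h1 hd2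
  rw [h2] at this
  rw [h4, h2]
  linarith

theorem graphIndex_hShape_lt_of_three_le {d : ℕ} (hd : 3 ≤ d) :
    graphIndex (hShape d) < 3 * √2 / 2 := by
  -- The upper bound is not strict, so `t` is taken slightly below `√2`, where the defect is still
  -- nonpositive for `d ≥ 3`.
  have h := graphIndex_hShape_le (t := 141 / 100) (by norm_num) (d := d) (by omega) (by
    refine div_nonpos_of_nonpos_of_nonneg ?_ (by norm_num)
    have := pow_le_pow_right₀ (show (1 : ℝ) ≤ 141 / 100 by norm_num) hd
    norm_num at this ⊢
    linarith)
  refine h.trans_lt ?_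
  have : (1413 / 1000 : ℝ) < √2 := Real.lt_sqrt_of_sq_lt (by norm_num)
  norm_num
  linarith

theorem mainTheorem10 (n : ℕ) (hn : 10 ≤ n) :
    graphIndex (hGraph n) ∈ Set.Ioo (Real.sqrt (2 + Real.sqrt 5)) (3 * Real.sqrt 2 / 2) ↔
      12 ≤ n := by
  obtain ⟨d, rfl⟩ : ∃ d, n = d + 9 := ⟨n - 9, by omega⟩
  -- `d + 9 - 4` and `d + 9 - 7` reduce definitionally to `d + 5` and `d + 2`.
  change graphIndex (hShape d) ∈ _ ↔ _
  constructor
  · intro h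
    by_contra hlt
    exact (lt_graphIndex_hShape_of_le_two (by omega) (by omega)).not_gt h.2
  · intro h
    exact ⟨sqrt_two_add_sqrt_five_lt (by omega), graphIndex_hShape_lt_of_three_le (by omega)⟩
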